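/- Let $\beta_1,\beta_2\in(0,1)$ and define $F:[0,1]^2\to[0,1]^2$ by $F(x,y)=(f(x),g(x,y))$, where $f(x)=2x$ and $g(x,y)=g_1(y)=y+y(1-y)(y-\beta_1)$ if $0\le x\le \tfrac12$, and $f(x)=2x-1$ and $g(x,y)=g_2(y)=y-y(1-y)(y-\beta_2)$ if $\tfrac12<x\le 1$. For $i=0,1$ let $A_i=[0,1]\times\{i\}$, and let $\mathcal B(A_i)$ be the set of points of $[0,1]^2$ whose $\omega$-limit set under $F$ is contained in $A_i$. Put $$L_\perp(i)=\tfrac12\ln g_1'(i)+\tfrac12\ln g_2'(i),$$ so that $L_\perp(0)=\tfrac12\ln(1-\beta_1)+\tfrac12\ln(1+\beta_2)$ and $L_\perp(1)=\tfrac12\ln\beta_1+\tfrac12\ln(2-\beta_2)$. For $i=0,1$, $L_\perp(i)$ is the normal Lyapunov exponent of $F$ at typical points of $A_i$: for Lebesgue-almost every $x\in[0,1]$, all iterates $F^n$ are differentiable at $(x,i)$ as maps on $[0,1]^2$, and $$\lim_{n\to\infty}\frac1n\ln\bigl\|\pi\, d_{(x,i)}F^n\,\pi v\bigr\|=L_\perp(i)$$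 for every $v\in\mathbb R^2$ with $\pi v\ne0$, where $\pi(v_1,v_2)=(0,v_2)$ is the projection onto the direction normal to $A_i$. Suppose that $L_\perp(0)<0$ and $L_\perp(1)<0$. Then $\mathcal B(A_0)$ and $\mathcal B(A_1)$ both have positive Lebesgue measure; and if $\beta_1\neq\beta_2$, then $\mathcal B(A_0)\cup\mathcal B(A_1)$ has full Lebesgue measure in $[0,1]^2$. -/

import Mathlib

open Set Filter Topology MeasureTheory

noncomputable section

namespace CubicSkew

/-- The phase space `[0,1] × [0,1]`. -/
def unitSquare : Set (ℝ × ℝ) := Icc (0 : ℝ) 1 ×ˢ Icc (0 : ℝ) 1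

/-- The doubling map `f` of the base. -/
def doubling (x : ℝ) : ℝ := if x ≤ 1 / 2 then 2 * x else 2 * x - 1

/-- The cubic fiber map `y + y(1-y)(y-β)`, applied over `0 ≤ x ≤ 1/2`. -/
def fiberOne (β y : ℝ) : ℝ := y + y * (1 - y) * (y - β)

/-- The cubic fiber map `y - y(1-y)(y-β)`, applied over `1/2 < x ≤ 1`. -/
def fiberTwo (β y : ℝ) : ℝ := y - y * (1 - y) * (y - β)

/-- The skew product `F(x,y) = (f(x), g(x,y))`. It is written on the plane so that derivatives
within the unit square can be taken; `skewProduct_mapsTo` says that it is a self-map of the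
unit square, and it is only ever used there. -/
def skewProduct (β₁ β₂ : ℝ) (p : ℝ × ℝ) : ℝ × ℝ :=
  (doubling p.1, if p.1 ≤ 1 / 2 then fiberOne β₁ p.2 else fiberTwo β₂ p.2)

theorem skewProduct_mapsTo {β₁ β₂ : ℝ} (h₁ : β₁ ∈ Ioo (0 : ℝ) 1) (h₂ : β₂ ∈ Ioo (0 : ℝ) 1) :
    MapsTo (skewProduct β₁ β₂) unitSquare unitSquare := by
  rintro ⟨x, y⟩ ⟨⟨hx0, hx1⟩, hy0, hy1⟩
  obtain ⟨a0, a1⟩ := h₁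
  obtain ⟨b0, b1⟩ := h₂
  dsimp only at hx0 hx1 hy0 hy1
  have hyy : 0 ≤ y * (1 - y) := mul_nonneg hy0 (by linarith)
  by_cases hx : x ≤ 1 / 2
  · simp only [skewProduct, doubling, fiberOne, hx, if_true, unitSquare, mem_prod, mem_Icc]
    refine ⟨⟨by linarith, by linarith⟩, ?_, ?_⟩ <;> nlinarith
  · simp only [skewProduct, doubling, fiberTwo, hx, if_false, unitSquare, mem_prod, mem_Icc]
    rw [not_le] at hx
    refine ⟨⟨by linarith, by linarith⟩, ?_, ?_⟩ <;> nlinarith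

/-- The invariant set `A_i = [0,1] × {i}`, for `i = 0, 1`. -/
def attractor (i : ℝ) : Set (ℝ × ℝ) := Icc (0 : ℝ) 1 ×ˢ {i}

/-- The basin of attraction of `A` under a self-map `F` of the unit square: the points whose
`ω`-limit set is contained in `A`. -/
def basin (F : ℝ × ℝ → ℝ × ℝ) (A : Set (ℝ × ℝ)) : Set (ℝ × ℝ) :=
  {p | p ∈ unitSquare ∧ omegaLimit atTop (fun (n : ℕ) (q : ℝ × ℝ) => F^[n] q) {p} ⊆ A}

/-- The orthogonal projection onto the direction normal to the horizontal lines. -/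
def normalPart (v : ℝ × ℝ) : ℝ × ℝ := (0, v.2)

/-- `F` has at the point `p` of a horizontal invariant line the normal Lyapunov exponent `L` in the
direction `v`: every iterate is differentiable at `p` (as a map on the unit square) and
`(1/n) log ‖π ∘ d_p Fⁿ ∘ π (v)‖ → L`, with `π` the projection onto the normal direction. -/
def HasNormalLyapunovExponentAt (F : ℝ × ℝ → ℝ × ℝ) (p v : ℝ × ℝ) (L : ℝ) : Prop :=
  (∀ n : ℕ, DifferentiableWithinAt ℝ (F^[n]) unitSquare p) ∧
  Tendsto (fun n : ℕ => 1 / (n : ℝ) *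
      Real.log ‖normalPart (fderivWithin ℝ (F^[n]) unitSquare p (normalPart v))‖)
    atTop (𝓝 L)

/-- The number `½ log g₁'(i) + ½ log g₂'(i)`, for `i = 0, 1`. -/
def normalExponent (β₁ β₂ i : ℝ) : ℝ :=
  1 / 2 * Real.log (deriv (fiberOne β₁) i) + 1 / 2 * Real.log (deriv (fiberTwo β₂) i)

end CubicSkew

end

namespace CubicSkew

/-! Under Lebesgue measure the branches visited by the doubling map form a fair coin-tossing
sequence, so Birkhoff averages of a function of the branch converge almost surely
(`ae_tendsto_birkhoff_branchValue`). Applied to the log-derivatives of the fiber maps at `i`, this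
gives the normal exponents.

Near a line with negative exponent, the fiber maps lie below linear maps whose logarithmic slopes
still have negative mean. The products of these slopes tend to zero almost surely, and are bounded
by one constant on a set of base points of measure at least one half; this gives a uniform
neighbourhood over that set (`exists_local_attraction_zero`). The conjugacy `y ↦ 1 - y` treats the
other line, and both basins have positive measure.

For full measure, let `p y` be the measure of the horizontal section at height `y` of the set
attracted to either line. If `β₁ ≠ β₂`, a bounded number of branch choices moves any height close to
a line, and each choice costs a factor 1/2, so `p` has a positive lower bound
(`exists_pos_le_boundarySection`). By invariance, that bound holds as a density at all dyadic scales
around every base point, and the Lebesgue density theorem makes the complement null. -/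

/-! ### The doubling map as a fair coin toss -/

/-- Lebesgue measure on `(0,1]`, a half-open interval which the doubling map leaves invariant. -/
noncomputable def baseMeasure : Measure ℝ := volume.restrict (Ioc 0 1)

theorem baseMeasure_eq_restrict_Icc : baseMeasure = volume.restrict (Icc (0 : ℝ) 1) :=
  Measure.restrict_congr_set Ioc_ae_eq_Icc

instance : IsProbabilityMeasure baseMeasure :=
  ⟨by simp [baseMeasure]⟩

theorem baseMeasure_apply (s : Set ℝ) : baseMeasure s = volume (s ∩ Ioc 0 1) :=
  Measure.restrict_apply' measurableSet_Ioc

theorem volume_preimage_two_mul (s : Set ℝ) : volume {x : ℝ | 2 * x ∈ s} = 2⁻¹ * volume s := by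
  have h := Real.volume_preimage_mul_left (a := 2) two_ne_zero s
  rw [abs_of_pos (by norm_num), ENNReal.ofReal_inv_of_pos two_pos, ENNReal.ofReal_ofNat] at h
  exact h

theorem volume_preimage_two_mul_sub_one (s : Set ℝ) :
    volume {x : ℝ | 2 * x - 1 ∈ s} = 2⁻¹ * volume s := by
  have h := volume_preimage_two_mul ((fun x => x + (-1)) ⁻¹' s)
  rw [measure_preimage_add_right] at h
  exact h

theorem baseMeasure_left (s : Set ℝ) :
    baseMeasure {x | x ≤ 1 / 2 ∧ 2 * x ∈ s} = 2⁻¹ * baseMeasure s := by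
  rw [baseMeasure_apply, baseMeasure_apply, ← volume_preimage_two_mul]
  congr 1
  ext x
  simp only [mem_inter_iff, mem_ofPred_eq, mem_Ioc]
  constructor
  · rintro ⟨⟨h, hs⟩, h0, h1⟩
    exact ⟨hs, by linarith, by linarith⟩
  · rintro ⟨hs, h0, h1⟩
    exact ⟨⟨by linarith, hs⟩, by linarith, by linarith⟩

theorem baseMeasure_right (s : Set ℝ) :
    baseMeasure {x | ¬ x ≤ 1 / 2 ∧ 2 * x - 1 ∈ s} = 2⁻¹ * baseMeasure s := by
  rw [baseMeasure_apply, baseMeasure_apply, ← volume_preimage_two_mul_sub_one]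
  congr 1
  ext x
  simp only [mem_inter_iff, mem_ofPred_eq, mem_Ioc, not_le]
  constructor
  · rintro ⟨⟨h, hs⟩, h0, h1⟩
    exact ⟨hs, by linarith, by linarith⟩
  · rintro ⟨hs, h0, h1⟩
    exact ⟨⟨by linarith, hs⟩, by linarith, by linarith⟩

theorem measurableSet_le_half : MeasurableSet {x : ℝ | x ≤ 1 / 2} := measurableSet_Iic

theorem baseMeasure_split (s : Set ℝ) :
    baseMeasure s = baseMeasure {x | x ≤ 1 / 2 ∧ x ∈ s} + baseMeasure {x | ¬ x ≤ 1 / 2 ∧ x ∈ s} := by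
  rw [← measure_inter_add_sdiff s measurableSet_le_half]
  congr 2 <;> ext x <;> simp [and_comm]

theorem measurable_doubling : Measurable doubling :=
  Measurable.ite measurableSet_le_half (by fun_prop) (by fun_prop)

/-- The function on the base with value `a` on the left branch and `b` on the right branch. -/
noncomputable def branchValue (a b x : ℝ) : ℝ := if x ≤ 1 / 2 then a else b

theorem measurable_branchValue (a b : ℝ) : Measurable (branchValue a b) :=
  Measurable.ite measurableSet_le_half measurable_const measurable_const

-- Each branch maps its half of `(0,1]` affinely onto `(0,1]`, so the current branch carries no
-- information about the image point. Both the invariance of the measure and the independence of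
-- successive branches follow.
open Classical in
theorem baseMeasure_branchValue_inter_doubling (a b : ℝ) (s t : Set ℝ) :
    baseMeasure (branchValue a b ⁻¹' s ∩ doubling ⁻¹' t) =
      ((if a ∈ s then 2⁻¹ else 0) + (if b ∈ s then 2⁻¹ else 0)) * baseMeasure t := by
  rw [baseMeasure_split, add_mul]
  congr 1
  · by_cases ha : a ∈ s
    · rw [if_pos ha, ← baseMeasure_left]
      congr 1; ext x
      simp only [mem_ofPred_eq, mem_inter_iff, mem_preimage, branchValue, doubling]
      refine and_congr_right fun hx => ?_
      simp only [if_pos hx, ha, true_and]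
    · rw [if_neg ha, zero_mul]
      convert measure_empty (μ := baseMeasure)
      ext x
      simp only [mem_ofPred_eq, mem_inter_iff, mem_preimage, branchValue, mem_empty_iff_false,
        iff_false]
      rintro ⟨hx, h, -⟩
      rw [if_pos hx] at h
      exact ha h
  · by_cases hb : b ∈ s
    · rw [if_pos hb, ← baseMeasure_right]
      congr 1; ext x
      simp only [mem_ofPred_eq, mem_inter_iff, mem_preimage, branchValue, doubling]
      refine and_congr_right fun hx => ?_
      simp only [if_neg hx, hb, true_and]
    · rw [if_neg hb, zero_mul]
      convert measure_empty (μ := baseMeasure)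
      ext x
      simp only [mem_ofPred_eq, mem_inter_iff, mem_preimage, branchValue, mem_empty_iff_false,
        iff_false]
      rintro ⟨hx, h, -⟩
      rw [if_neg hx] at h
      exact hb h

theorem measurePreserving_doubling : MeasurePreserving doubling baseMeasure baseMeasure := by
  refine ⟨measurable_doubling, Measure.ext fun t ht => ?_⟩
  rw [Measure.map_apply measurable_doubling ht]
  have h := baseMeasure_branchValue_inter_doubling 0 0 univ t
  simpa [ENNReal.inv_two_add_inv_two] using h

theorem baseMeasure_branchValue_inter_doubling_eq_mul (a b : ℝ) (s t : Set ℝ) :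
    baseMeasure (branchValue a b ⁻¹' s ∩ doubling ⁻¹' t) =
      baseMeasure (branchValue a b ⁻¹' s) * baseMeasure t := by
  classical
  have h := baseMeasure_branchValue_inter_doubling a b s univ
  rw [preimage_univ, inter_univ, measure_univ, mul_one] at h
  rw [h, baseMeasure_branchValue_inter_doubling]

-- Invariance under `doubling^[i]` reduces to the case where the earlier time is 0; the later
-- variable is then a function of the image under `doubling`.
open ProbabilityTheory in
theorem indepFun_branchValue_of_lt (a b : ℝ) {i j : ℕ} (hij : i < j) :
    IndepFun (branchValue a b ∘ doubling^[i]) (branchValue a b ∘ doubling^[j]) baseMeasure := by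
  rw [indepFun_iff_measure_inter_preimage_eq_mul]
  intro s t hs ht
  obtain ⟨k, rfl⟩ := Nat.exists_eq_add_of_lt hij
  have hφ := measurable_branchValue a b
  have hk : MeasurableSet (doubling^[k] ⁻¹' (branchValue a b ⁻¹' t)) :=
    (measurePreserving_doubling.iterate k).measurable (hφ ht)
  have e : (branchValue a b ∘ doubling^[i + k + 1]) ⁻¹' t =
      doubling^[i] ⁻¹' (doubling ⁻¹' (doubling^[k] ⁻¹' (branchValue a b ⁻¹' t))) := by
    rw [show i + k + 1 = k + 1 + i by ring, Function.iterate_add, Function.iterate_succ]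
    rfl
  have hi := measurePreserving_doubling.iterate i
  rw [e, preimage_comp, ← preimage_inter,
    hi.measure_preimage ((hφ hs).inter (measurable_doubling hk)).nullMeasurableSet,
    hi.measure_preimage (hφ hs).nullMeasurableSet,
    hi.measure_preimage (measurable_doubling hk).nullMeasurableSet,
    baseMeasure_branchValue_inter_doubling_eq_mul,
    measurePreserving_doubling.measure_preimage hk.nullMeasurableSet]

theorem integral_branchValue (a b : ℝ) :
    ∫ x, branchValue a b x ∂baseMeasure = 1 / 2 * a + 1 / 2 * b := by
  have hl : baseMeasure.real {x | x ≤ 1 / 2} = 1 / 2 := by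
    have := baseMeasure_left univ
    simp only [mem_univ, and_true, measure_univ, mul_one] at this
    rw [Measure.real, this]
    simp
  have e : branchValue a b = fun x => indicator {x | x ≤ 1 / 2} (fun _ => a - b) x + b := by
    ext x
    by_cases hx : x ≤ 1 / 2
    · rw [branchValue, if_pos hx, indicator_of_mem (show x ∈ {x | x ≤ 1 / 2} from hx)]; ring
    · rw [branchValue, if_neg hx, indicator_of_notMem (show x ∉ {x | x ≤ 1 / 2} from hx)]; ring
  rw [e, integral_add ((integrable_const _).indicator measurableSet_le_half) (integrable_const _),
    integral_indicator_const _ measurableSet_le_half, hl]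
  simp
  ring

/-- Pairwise independence suffices for the strong law of large numbers, so ergodicity is not needed.
-/
theorem ae_tendsto_birkhoff_branchValue (a b : ℝ) :
    ∀ᵐ x ∂baseMeasure, Tendsto
      (fun n : ℕ => (∑ k ∈ Finset.range n, branchValue a b (doubling^[k] x)) / n) atTop
      (𝓝 (1 / 2 * a + 1 / 2 * b)) := by
  have hφ := measurable_branchValue a b
  have h := ProbabilityTheory.strong_law_ae_real (μ := baseMeasure)
    (fun k => branchValue a b ∘ doubling^[k]) ?_ ?_ ?_
  · rw [← integral_branchValue]
    exact h
  · refine Integrable.of_bound (C := max |a| |b|) (by simpa using hφ.aestronglyMeasurable)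
      (Eventually.of_forall fun x => ?_)
    simp only [Function.iterate_zero, Function.comp_id, branchValue, Real.norm_eq_abs]
    split_ifs <;> simp
  · intro i j hij
    rcases hij.lt_or_gt with h | h
    · exact indepFun_branchValue_of_lt a b h
    · exact (indepFun_branchValue_of_lt a b h).symm
  · intro i
    have hi := measurePreserving_doubling.iterate i
    refine ⟨(hφ.comp hi.measurable).aemeasurable, by simpa using hφ.aemeasurable, ?_⟩
    rw [← Measure.map_map hφ hi.measurable, hi.map_eq]
    rfl

theorem ae_iterate_doubling_ne_half :
    ∀ᵐ x ∂baseMeasure, ∀ n : ℕ, doubling^[n] x ≠ 1 / 2 := by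
  rw [ae_all_iff]
  intro n
  have h : ∀ᵐ x ∂baseMeasure, x ≠ 1 / 2 := by
    rw [baseMeasure]
    exact ae_restrict_of_ae (Measure.ae_ne volume (1 / 2))
  exact (measurePreserving_doubling.iterate n).quasiMeasurePreserving.ae h

/-! ### Derivatives and normal Lyapunov exponents -/

theorem hasDerivAt_fiberOne (β y : ℝ) :
    HasDerivAt (fiberOne β) (1 + (1 - 2 * y) * (y - β) + y * (1 - y)) y := by
  have h := (hasDerivAt_id y).add (((hasDerivAt_id y).mul
    ((hasDerivAt_id y).const_sub 1)).mul ((hasDerivAt_id y).sub_const β))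
  refine h.congr_deriv ?_
  simp only [id, Pi.mul_apply]
  ring

theorem hasDerivAt_fiberTwo (β y : ℝ) :
    HasDerivAt (fiberTwo β) (1 - (1 - 2 * y) * (y - β) - y * (1 - y)) y := by
  have h := (hasDerivAt_id y).sub (((hasDerivAt_id y).mul
    ((hasDerivAt_id y).const_sub 1)).mul ((hasDerivAt_id y).sub_const β))
  refine h.congr_deriv ?_
  simp only [id, Pi.mul_apply]
  ring

theorem normalExponent_zero (β₁ β₂ : ℝ) :
    normalExponent β₁ β₂ 0 = 1 / 2 * Real.log (1 - β₁) + 1 / 2 * Real.log (1 + β₂) := by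
  rw [normalExponent, (hasDerivAt_fiberOne β₁ 0).deriv, (hasDerivAt_fiberTwo β₂ 0).deriv]
  congr 3 <;> ring

theorem normalExponent_one_sub (β₁ β₂ : ℝ) :
    normalExponent (1 - β₁) (1 - β₂) 0 = normalExponent β₁ β₂ 1 := by
  rw [normalExponent_zero, normalExponent, (hasDerivAt_fiberOne β₁ 1).deriv,
    (hasDerivAt_fiberTwo β₂ 1).deriv]
  congr 3 <;> ring

theorem iterate_skewProduct_fst (β₁ β₂ : ℝ) (n : ℕ) (p : ℝ × ℝ) :
    ((skewProduct β₁ β₂)^[n] p).1 = doubling^[n] p.1 := by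
  induction n generalizing p with
  | zero => rfl
  | succ n ih => rw [Function.iterate_succ_apply, Function.iterate_succ_apply, ih]; rfl

theorem iterate_skewProduct_invariant (β₁ β₂ : ℝ) {i : ℝ} (hi : i = 0 ∨ i = 1) (n : ℕ) (x : ℝ) :
    (skewProduct β₁ β₂)^[n] (x, i) = (doubling^[n] x, i) := by
  induction n generalizing x with
  | zero => rfl
  | succ n ih =>
    rw [Function.iterate_succ_apply, Function.iterate_succ_apply, ← ih]
    congr 1
    simp only [skewProduct, fiberOne, fiberTwo, Prod.mk.injEq, true_and]
    rcases hi with rfl | rfl <;> simp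

/-- The derivative of the skew product at `(x,y)`: expansion by `2` along the base, and the
derivative of the fiber map along the fiber. -/
noncomputable def skewDeriv (β₁ β₂ : ℝ) (x y : ℝ) : ℝ × ℝ →L[ℝ] ℝ × ℝ :=
  ((2 : ℝ) • ContinuousLinearMap.fst ℝ ℝ ℝ).prod
    (branchValue (deriv (fiberOne β₁) y) (deriv (fiberTwo β₂) y) x • ContinuousLinearMap.snd ℝ ℝ ℝ)

theorem hasFDerivAt_skewProduct (β₁ β₂ : ℝ) {x : ℝ} (hx : x ≠ 1 / 2) (y : ℝ) :
    HasFDerivAt (skewProduct β₁ β₂) (skewDeriv β₁ β₂ x y) (x, y) := by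
  have hfst : HasFDerivAt (fun p : ℝ × ℝ => 2 * p.1)
      ((2 : ℝ) • ContinuousLinearMap.fst ℝ ℝ ℝ) (x, y) := hasFDerivAt_fst.const_mul 2
  have hsnd {g : ℝ → ℝ} {g' : ℝ} (h : HasDerivAt g g' y) :
      HasFDerivAt (fun p : ℝ × ℝ => g p.2) (g' • ContinuousLinearMap.snd ℝ ℝ ℝ) (x, y) :=
    HasDerivAt.comp_hasFDerivAt (x, y) (f := Prod.snd) (h₂ := g) h hasFDerivAt_snd
  rcases hx.lt_or_gt with h | h
  · have hd := hfst.prodMk (hsnd (hasDerivAt_fiberOne β₁ y).differentiableAt.hasDerivAt)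
    rw [skewDeriv, branchValue, if_pos h.le]
    refine hd.congr_of_eventuallyEq ?_
    filter_upwards [continuous_fst.continuousAt.eventually_lt continuousAt_const h] with p hp
    simp only [skewProduct, doubling, if_pos hp.le]
  · have hd := (hfst.sub_const 1).prodMk
      (hsnd (hasDerivAt_fiberTwo β₂ y).differentiableAt.hasDerivAt)
    rw [skewDeriv, branchValue, if_neg h.not_ge]
    refine hd.congr_of_eventuallyEq ?_
    filter_upwards [continuousAt_const.eventually_lt continuous_fst.continuousAt h] with p hp
    simp only [skewProduct, doubling, if_neg (not_le.2 hp)]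

/-- The differentials preserve the vertical direction, so the chain rule on vertical vectors is a
product of scalars. The orbit must avoid 1/2, where the base map jumps. -/
theorem exists_hasFDerivAt_iterate (β₁ β₂ : ℝ) {i : ℝ} (hi : i = 0 ∨ i = 1) {x : ℝ}
    (hx : ∀ n : ℕ, doubling^[n] x ≠ 1 / 2) (n : ℕ) :
    ∃ D : ℝ × ℝ →L[ℝ] ℝ × ℝ, HasFDerivAt ((skewProduct β₁ β₂)^[n]) D (x, i) ∧
      ∀ t : ℝ, D (0, t) = (0, (∏ k ∈ Finset.range n,
        branchValue (deriv (fiberOne β₁) i) (deriv (fiberTwo β₂) i) (doubling^[k] x)) * t) := by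
  induction n with
  | zero => exact ⟨_, hasFDerivAt_id _, by simp⟩
  | succ n ih =>
    obtain ⟨D, hD, hDt⟩ := ih
    have hF := hasFDerivAt_skewProduct β₁ β₂ (hx n) i
    rw [← iterate_skewProduct_invariant β₁ β₂ hi] at hF
    refine ⟨_, by rw [Function.iterate_succ']; exact hF.comp (x, i) hD, fun t => ?_⟩
    rw [ContinuousLinearMap.comp_apply, hDt, Finset.prod_range_succ]
    simp [skewDeriv]
    ring

theorem uniqueDiffOn_unitSquare : UniqueDiffOn ℝ unitSquare :=
  uniqueDiffOn_Icc_zero_one.prod uniqueDiffOn_Icc_zero_one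

theorem hasNormalLyapunovExponentAt_of_tendsto {β₁ β₂ : ℝ} {i : ℝ} (hi : i = 0 ∨ i = 1)
    (h₁ : 0 < deriv (fiberOne β₁) i) (h₂ : 0 < deriv (fiberTwo β₂) i) {x : ℝ}
    (hx01 : x ∈ Icc (0 : ℝ) 1) (hx : ∀ n : ℕ, doubling^[n] x ≠ 1 / 2) {L : ℝ}
    (hL : Tendsto (fun n : ℕ => (∑ k ∈ Finset.range n, branchValue (Real.log (deriv (fiberOne β₁) i))
      (Real.log (deriv (fiberTwo β₂) i)) (doubling^[k] x)) / n) atTop (𝓝 L))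
    {v : ℝ × ℝ} (hv : normalPart v ≠ 0) :
    HasNormalLyapunovExponentAt (skewProduct β₁ β₂) (x, i) v L := by
  have hmem : (x, i) ∈ unitSquare := ⟨hx01, by rcases hi with rfl | rfl <;> simp⟩
  have hv2 : v.2 ≠ 0 := fun h => hv (by rw [normalPart, h]; rfl)
  refine ⟨fun n => ?_, ?_⟩
  · obtain ⟨D, hD, -⟩ := exists_hasFDerivAt_iterate β₁ β₂ hi hx n
    exact hD.differentiableAt.differentiableWithinAt
  -- The length of `v` contributes only `log |v.2| / n`, which vanishes in the limit.
  have hconst : Tendsto (fun n : ℕ => 1 / (n : ℝ) * Real.log |v.2|) atTop (𝓝 0) := by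
    simpa using tendsto_one_div_atTop_nhds_zero_nat.mul_const (Real.log |v.2|)
  have hsum := hL.add hconst
  rw [add_zero] at hsum
  refine hsum.congr fun n => ?_
  obtain ⟨D, hD, hDt⟩ := exists_hasFDerivAt_iterate β₁ β₂ hi hx n
  rw [hD.hasFDerivWithinAt.fderivWithin (uniqueDiffOn_unitSquare _ hmem)]
  have hpos : ∀ z, 0 < branchValue (deriv (fiberOne β₁) i) (deriv (fiberTwo β₂) i) z := by
    intro z
    rw [branchValue]
    split_ifs <;> assumption
  have hlog : ∀ z, Real.log (branchValue (deriv (fiberOne β₁) i) (deriv (fiberTwo β₂) i) z) =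
      branchValue (Real.log (deriv (fiberOne β₁) i)) (Real.log (deriv (fiberTwo β₂) i)) z := by
    intro z
    simp only [branchValue]
    split_ifs <;> rfl
  have hprod := Finset.prod_pos fun k (_ : k ∈ Finset.range n) => hpos (doubling^[k] x)
  have hnorm : ‖normalPart (D (normalPart v))‖ = (∏ k ∈ Finset.range n,
      branchValue (deriv (fiberOne β₁) i) (deriv (fiberTwo β₂) i) (doubling^[k] x)) * |v.2| := by
    rw [normalPart, normalPart, hDt, Prod.norm_def]
    simp only [norm_zero, Real.norm_eq_abs, abs_mul, abs_of_pos hprod]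
    exact max_eq_right (by positivity)
  rw [hnorm, Real.log_mul hprod.ne' (abs_pos.2 hv2).ne',
    Real.log_prod fun k _ => (hpos _).ne', mul_add, Finset.sum_congr rfl fun k _ => hlog _]
  ring

theorem deriv_fiberOne_pos {β : ℝ} (hβ : β ∈ Ioo (0 : ℝ) 1) {i : ℝ} (hi : i = 0 ∨ i = 1) :
    0 < deriv (fiberOne β) i := by
  rw [(hasDerivAt_fiberOne β i).deriv]
  obtain ⟨h0, h1⟩ := hβ
  rcases hi with rfl | rfl <;> linarith

theorem deriv_fiberTwo_pos {β : ℝ} (hβ : β ∈ Ioo (0 : ℝ) 1) {i : ℝ} (hi : i = 0 ∨ i = 1) :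
    0 < deriv (fiberTwo β) i := by
  rw [(hasDerivAt_fiberTwo β i).deriv]
  obtain ⟨h0, h1⟩ := hβ
  rcases hi with rfl | rfl <;> linarith

theorem ae_hasNormalLyapunovExponentAt {β₁ β₂ : ℝ} (hβ₁ : β₁ ∈ Ioo (0 : ℝ) 1)
    (hβ₂ : β₂ ∈ Ioo (0 : ℝ) 1) {i : ℝ} (hi : i = 0 ∨ i = 1) :
    ∀ᵐ x ∂(volume.restrict (Icc (0 : ℝ) 1)), ∀ v : ℝ × ℝ, normalPart v ≠ 0 →
      HasNormalLyapunovExponentAt (skewProduct β₁ β₂) (x, i) v (normalExponent β₁ β₂ i) := by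
  have hmem := ae_restrict_mem (μ := (volume : Measure ℝ)) (measurableSet_Icc (a := (0 : ℝ)) (b := 1))
  rw [← baseMeasure_eq_restrict_Icc] at hmem ⊢
  filter_upwards [hmem, ae_iterate_doubling_ne_half, ae_tendsto_birkhoff_branchValue
    (Real.log (deriv (fiberOne β₁) i)) (Real.log (deriv (fiberTwo β₂) i))] with x hx01 hx hL v hv
  exact hasNormalLyapunovExponentAt_of_tendsto hi (deriv_fiberOne_pos hβ₁ hi)
    (deriv_fiberTwo_pos hβ₂ hi) hx01 hx hL hv

/-! ### Convergence to a line and local attraction -/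

/-- The points whose orbit converges to the horizontal line at height `i`. -/
def attractedTo (β₁ β₂ i : ℝ) : Set (ℝ × ℝ) :=
  {p | Tendsto (fun n : ℕ => ((skewProduct β₁ β₂)^[n] p).2) atTop (𝓝 i)}

theorem mem_attractedTo_iff_skewProduct (β₁ β₂ i : ℝ) (p : ℝ × ℝ) :
    p ∈ attractedTo β₁ β₂ i ↔ skewProduct β₁ β₂ p ∈ attractedTo β₁ β₂ i :=
  (tendsto_add_atTop_iff_nat (f := fun n : ℕ => ((skewProduct β₁ β₂)^[n] p).2) 1).symm

theorem measurable_skewProduct (β₁ β₂ : ℝ) : Measurable (skewProduct β₁ β₂) := by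
  refine (measurable_doubling.comp measurable_fst).prodMk
    (Measurable.ite (measurable_fst measurableSet_le_half) ?_ ?_)
  · unfold fiberOne
    fun_prop
  · unfold fiberTwo
    fun_prop

theorem measurableSet_attractedTo (β₁ β₂ i : ℝ) : MeasurableSet (attractedTo β₁ β₂ i) :=
  measurableSet_tendsto (𝓝 i) fun n => measurable_snd.comp ((measurable_skewProduct β₁ β₂).iterate n)

theorem mem_basin_of_mem_attractedTo {β₁ β₂ : ℝ} (hβ₁ : β₁ ∈ Ioo (0 : ℝ) 1)
    (hβ₂ : β₂ ∈ Ioo (0 : ℝ) 1) {i : ℝ} {p : ℝ × ℝ} (hp : p ∈ unitSquare)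
    (h : p ∈ attractedTo β₁ β₂ i) : p ∈ basin (skewProduct β₁ β₂) (attractor i) := by
  refine ⟨hp, fun q hq => ?_⟩
  have key : ∀ ε > 0, q ∈ unitSquare ∩ {r : ℝ × ℝ | |r.2 - i| ≤ ε} := by
    intro ε hε
    have hclosed : IsClosed (unitSquare ∩ {r : ℝ × ℝ | |r.2 - i| ≤ ε}) :=
      (isClosed_Icc.prod isClosed_Icc).inter (isClosed_le (by fun_prop) continuous_const)
    have hu : {n : ℕ | |((skewProduct β₁ β₂)^[n] p).2 - i| ≤ ε} ∈ (atTop : Filter ℕ) := by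
      filter_upwards [Metric.tendsto_nhds.1 h ε hε] with n hn
      exact le_of_lt hn
    refine closure_minimal ?_ hclosed (mem_iInter₂.1 hq _ hu)
    rintro r ⟨n, hn, p', rfl, rfl⟩
    exact ⟨(skewProduct_mapsTo hβ₁ hβ₂).iterate n hp, hn⟩
  refine ⟨(key 1 one_pos).1.1, ?_⟩
  have h0 : |q.2 - i| ≤ 0 := le_of_forall_pos_le_add fun ε hε => by simpa using (key ε hε).2
  exact sub_eq_zero.1 (abs_nonpos_iff.1 h0)

/-- The reflection `y ↦ 1 - y` conjugates the system to the one with parameters `1 - βᵢ`, exchanging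
the two lines. -/
theorem iterate_skewProduct_one_sub (β₁ β₂ : ℝ) (n : ℕ) (x y : ℝ) :
    ((skewProduct β₁ β₂)^[n] (x, 1 - y)).2 =
      1 - ((skewProduct (1 - β₁) (1 - β₂))^[n] (x, y)).2 := by
  induction n generalizing x y with
  | zero => rfl
  | succ n ih =>
    rw [Function.iterate_succ_apply, Function.iterate_succ_apply]
    simp only [skewProduct]
    rw [← ih]
    congr 3
    simp only [fiberOne, fiberTwo]
    split_ifs <;> ring

theorem mem_attractedTo_one_sub_iff (β₁ β₂ i x y : ℝ) :
    (x, 1 - y) ∈ attractedTo β₁ β₂ (1 - i) ↔ (x, y) ∈ attractedTo (1 - β₁) (1 - β₂) i := by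
  simp only [attractedTo, mem_ofPred_eq, iterate_skewProduct_one_sub]
  constructor
  · intro h
    simpa using h.const_sub 1
  · intro h
    exact h.const_sub 1

/-- The bound at time `n` keeps the orbit in `[0, δ]`, which is what permits the linear comparison
at the next step. -/
theorem iterate_snd_le_of_forall_mul_exp_le {β₁ β₂ a b δ : ℝ} (hβ₁ : β₁ ∈ Ioo (0 : ℝ) 1)
    (hβ₂ : β₂ ∈ Ioo (0 : ℝ) 1)
    (h₁ : ∀ y ∈ Icc 0 δ, fiberOne β₁ y ≤ Real.exp a * y)
    (h₂ : ∀ y ∈ Icc 0 δ, fiberTwo β₂ y ≤ Real.exp b * y) {x y : ℝ} (hp : (x, y) ∈ unitSquare)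
    (hδ : ∀ n : ℕ, Real.exp (∑ k ∈ Finset.range n, branchValue a b (doubling^[k] x)) * y ≤ δ)
    (n : ℕ) : ((skewProduct β₁ β₂)^[n] (x, y)).2 ≤
      Real.exp (∑ k ∈ Finset.range n, branchValue a b (doubling^[k] x)) * y := by
  induction n with
  | zero => simp
  | succ n ih =>
    have hn : (skewProduct β₁ β₂)^[n] (x, y) ∈ unitSquare :=
      (skewProduct_mapsTo hβ₁ hβ₂).iterate n hp
    have hmem : ((skewProduct β₁ β₂)^[n] (x, y)).2 ∈ Icc 0 δ := ⟨hn.2.1, ih.trans (hδ n)⟩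
    have hstep : ((skewProduct β₁ β₂)^[n + 1] (x, y)).2 ≤
        Real.exp (branchValue a b (doubling^[n] x)) * ((skewProduct β₁ β₂)^[n] (x, y)).2 := by
      rw [Function.iterate_succ_apply', ← iterate_skewProduct_fst β₁ β₂ n (x, y)]
      by_cases hx : ((skewProduct β₁ β₂)^[n] (x, y)).1 ≤ 1 / 2
      · simp only [skewProduct, branchValue, if_pos hx]
        exact h₁ _ hmem
      · simp only [skewProduct, branchValue, if_neg hx]
        exact h₂ _ hmem
    refine hstep.trans ?_
    rw [Finset.sum_range_succ, add_comm, Real.exp_add, mul_assoc]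
    exact mul_le_mul_of_nonneg_left ih (Real.exp_pos _).le

/-- The threshold comes from `1 + (1 - y)(y - β) ≤ (1 - β) + 2y`. -/
theorem fiberOne_le_of_le {β ε y : ℝ} (hβ : β ∈ Ioo (0 : ℝ) 1)
    (hy : y ∈ Icc 0 (min 1 ((1 - β) * (Real.exp ε - 1) / 2))) :
    fiberOne β y ≤ Real.exp (Real.log (1 - β) + ε) * y := by
  obtain ⟨h0, h1⟩ := hβ
  obtain ⟨hy0, hy1⟩ := hy
  have ha := hy1.trans (min_le_left _ _)
  have hb := hy1.trans (min_le_right _ _)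
  rw [Real.exp_add, Real.exp_log (by linarith), fiberOne]
  have : 0 ≤ y * ((1 - β) * Real.exp ε - (1 + (1 - y) * (y - β))) :=
    mul_nonneg hy0 (by nlinarith)
  linarith

/-- No smallness of `y` is needed: `1 - (1 - y)(y - β) ≤ 1 + β` on all of `[0,1]`. -/
theorem fiberTwo_le_of_le {β ε y : ℝ} (hβ : β ∈ Ioo (0 : ℝ) 1) (hε : 0 ≤ ε)
    (hy : y ∈ Icc (0 : ℝ) 1) : fiberTwo β y ≤ Real.exp (Real.log (1 + β) + ε) * y := by
  obtain ⟨h0, h1⟩ := hβ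
  obtain ⟨hy0, hy1⟩ := hy
  rw [Real.exp_add, Real.exp_log (by linarith), fiberTwo]
  have he := Real.one_le_exp hε
  have : 0 ≤ y * ((1 + β) * Real.exp ε - (1 - (1 - y) * (y - β))) :=
    mul_nonneg hy0 (by nlinarith)
  linarith

/-- A transversally attracting line attracts a uniform neighbourhood, over a set of base points of
measure at least one half. -/
theorem exists_local_attraction_zero {β₁ β₂ : ℝ} (hβ₁ : β₁ ∈ Ioo (0 : ℝ) 1)
    (hβ₂ : β₂ ∈ Ioo (0 : ℝ) 1) (hL : normalExponent β₁ β₂ 0 < 0) :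
    ∃ δ ∈ Ioc (0 : ℝ) 1, ∃ C ⊆ Icc (0 : ℝ) 1, 1 / 2 ≤ baseMeasure C ∧
      ∀ x ∈ C, ∀ y ∈ Icc 0 δ, (x, y) ∈ attractedTo β₁ β₂ 0 := by
  set L := normalExponent β₁ β₂ 0 with hLdef
  rw [normalExponent_zero] at hLdef
  -- With this choice the mean of `a` and `b` is `L + ε = L / 2`, still negative.
  set ε := -L / 2 with hε
  have hε0 : 0 < ε := by linarith
  set a := Real.log (1 - β₁) + ε with ha
  set b := Real.log (1 + β₂) + ε with hb
  set δ := min 1 ((1 - β₁) * (Real.exp ε - 1) / 2) with hδ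
  have hδ0 : 0 < δ := by
    have h1 : 0 < 1 - β₁ := by linarith [hβ₁.2]
    have h2 : 0 < Real.exp ε - 1 := by linarith [Real.add_one_lt_exp hε0.ne']
    exact lt_min one_pos (by positivity)
  have hδ1 : δ ≤ 1 := min_le_left _ _
  have h₁ : ∀ y ∈ Icc 0 δ, fiberOne β₁ y ≤ Real.exp a * y := fun y hy => fiberOne_le_of_le hβ₁ hy
  have h₂ : ∀ y ∈ Icc 0 δ, fiberTwo β₂ y ≤ Real.exp b * y := fun y hy =>
    fiberTwo_le_of_le hβ₂ hε0.le ⟨hy.1, hy.2.trans hδ1⟩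
  set E : ℕ → ℝ → ℝ := fun n x =>
    Real.exp (∑ k ∈ Finset.range n, branchValue a b (doubling^[k] x)) with hE
  have hlim : ∀ᵐ x ∂baseMeasure, Tendsto (fun n => E n x) atTop (𝓝 0) := by
    filter_upwards [ae_tendsto_birkhoff_branchValue a b] with x hx
    have hneg : 1 / 2 * a + 1 / 2 * b < 0 := by linarith
    refine Real.tendsto_exp_atBot.comp ?_
    have h := hx.neg_mul_atTop hneg tendsto_natCast_atTop_atTop
    refine h.congr' ?_
    filter_upwards [eventually_ne_atTop 0] with n hn
    field_simp
  -- A convergent sequence is bounded, so these sets increase to a set of full measure and one of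
  -- them has measure above one half.
  set C : ℕ → Set ℝ := fun K => Icc (0 : ℝ) 1 ∩
    {x | (∀ n, E n x ≤ K) ∧ Tendsto (fun n => E n x) atTop (𝓝 0)} with hC
  have hmono : Monotone C := fun K M hKM x hx =>
    ⟨hx.1, fun n => (hx.2.1 n).trans (by exact_mod_cast hKM), hx.2.2⟩
  have hunion : baseMeasure (⋃ K, C K) = 1 := by
    rw [← measure_univ (μ := baseMeasure)]
    refine measure_congr (eventuallyEq_univ.2 ?_)
    have hmem : ∀ᵐ x ∂baseMeasure, x ∈ Icc (0 : ℝ) 1 := by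
      rw [baseMeasure_eq_restrict_Icc]
      exact ae_restrict_mem measurableSet_Icc
    filter_upwards [hlim, hmem] with x hx hx01
    obtain ⟨B, hB⟩ := hx.bddAbove_range
    obtain ⟨K, hK⟩ := exists_nat_ge B
    exact mem_iUnion.2 ⟨K, hx01, fun n => (hB (mem_range_self n)).trans hK, hx⟩
  have hten := tendsto_measure_iUnion_atTop (μ := baseMeasure) hmono
  rw [hunion] at hten
  obtain ⟨K, hK⟩ := (hten.eventually (lt_mem_nhds ENNReal.one_half_lt_one)).exists
  have hK1 : (0 : ℝ) < K + 1 := by positivity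
  -- Dividing by `K + 1` keeps `E n x * y ≤ δ` at all times, and avoids division by zero when `K =
  -- 0`.
  refine ⟨δ / (K + 1), ⟨by positivity, ?_⟩, C K, inter_subset_left, (one_div (2 : ENNReal)).le.trans hK.le, ?_⟩
  · exact (div_le_self hδ0.le (by linarith [K.cast_nonneg (α := ℝ)])).trans hδ1
  rintro x ⟨hx01, hxK, hx⟩ y ⟨hy0, hy⟩
  rw [le_div_iff₀ hK1] at hy
  have hy1 : y ≤ 1 := by nlinarith [K.cast_nonneg (α := ℝ)]
  have hp : (x, y) ∈ unitSquare := ⟨hx01, hy0, hy1⟩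
  have hbd : ∀ n, E n x * y ≤ δ := fun n => by nlinarith [hxK n]
  have hz : Tendsto (fun n => E n x * y) atTop (𝓝 0) := by simpa using hx.mul_const y
  exact squeeze_zero (fun n => ((skewProduct_mapsTo hβ₁ hβ₂).iterate n hp).2.1)
    (iterate_snd_le_of_forall_mul_exp_le hβ₁ hβ₂ h₁ h₂ hp hbd) hz

theorem one_sub_mem_Ioo {β : ℝ} (hβ : β ∈ Ioo (0 : ℝ) 1) : 1 - β ∈ Ioo (0 : ℝ) 1 :=
  ⟨by linarith [hβ.2], by linarith [hβ.1]⟩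

theorem exists_local_attraction_one {β₁ β₂ : ℝ} (hβ₁ : β₁ ∈ Ioo (0 : ℝ) 1)
    (hβ₂ : β₂ ∈ Ioo (0 : ℝ) 1) (hL : normalExponent β₁ β₂ 1 < 0) :
    ∃ δ ∈ Ioc (0 : ℝ) 1, ∃ C ⊆ Icc (0 : ℝ) 1, 1 / 2 ≤ baseMeasure C ∧
      ∀ x ∈ C, ∀ y ∈ Icc (1 - δ) 1, (x, y) ∈ attractedTo β₁ β₂ 1 := by
  rw [← normalExponent_one_sub] at hL
  obtain ⟨δ, hδ, C, hC, hm, h⟩ :=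
    exists_local_attraction_zero (one_sub_mem_Ioo hβ₁) (one_sub_mem_Ioo hβ₂) hL
  refine ⟨δ, hδ, C, hC, hm, fun x hx y hy => ?_⟩
  have := (mem_attractedTo_one_sub_iff β₁ β₂ 0 x (1 - y)).2
    (h x hx (1 - y) ⟨by linarith [hy.2], by linarith [hy.1]⟩)
  simpa using this

/-! ### Positive measure of the basins -/

theorem volume_pos_of_half_le_baseMeasure {C : Set ℝ} (hC : C ⊆ Icc 0 1)
    (hm : 1 / 2 ≤ baseMeasure C) {c d : ℝ} (hcd : c < d) {B : Set (ℝ × ℝ)}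
    (hB : C ×ˢ Icc c d ⊆ B) : 0 < volume B := by
  refine lt_of_lt_of_le ?_ (measure_mono hB)
  rw [Measure.volume_eq_prod, Measure.prod_prod, Real.volume_Icc]
  rw [baseMeasure_eq_restrict_Icc, Measure.restrict_apply' measurableSet_Icc,
    inter_eq_left.2 hC] at hm
  exact ENNReal.mul_pos ((lt_of_lt_of_le (by simp) hm).ne')
    (ENNReal.ofReal_pos.2 (sub_pos.2 hcd)).ne'

theorem volume_basin_zero_pos {β₁ β₂ : ℝ} (hβ₁ : β₁ ∈ Ioo (0 : ℝ) 1) (hβ₂ : β₂ ∈ Ioo (0 : ℝ) 1)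
    (hL : normalExponent β₁ β₂ 0 < 0) :
    0 < volume (basin (skewProduct β₁ β₂) (attractor 0)) := by
  obtain ⟨δ, hδ, C, hC, hm, h⟩ := exists_local_attraction_zero hβ₁ hβ₂ hL
  refine volume_pos_of_half_le_baseMeasure hC hm hδ.1 ?_
  rintro ⟨x, y⟩ ⟨hx, hy⟩
  exact mem_basin_of_mem_attractedTo hβ₁ hβ₂ ⟨hC hx, hy.1, hy.2.trans hδ.2⟩ (h x hx y hy)

theorem volume_basin_one_pos {β₁ β₂ : ℝ} (hβ₁ : β₁ ∈ Ioo (0 : ℝ) 1) (hβ₂ : β₂ ∈ Ioo (0 : ℝ) 1)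
    (hL : normalExponent β₁ β₂ 1 < 0) :
    0 < volume (basin (skewProduct β₁ β₂) (attractor 1)) := by
  obtain ⟨δ, hδ, C, hC, hm, h⟩ := exists_local_attraction_one hβ₁ hβ₂ hL
  refine volume_pos_of_half_le_baseMeasure hC hm (c := 1 - δ) (d := 1) (by linarith [hδ.1]) ?_
  rintro ⟨x, y⟩ ⟨hx, hy⟩
  refine mem_basin_of_mem_attractedTo hβ₁ hβ₂ ⟨hC hx, ?_, hy.2⟩ (h x hx y hy)
  exact le_trans (by linarith [hδ.2]) hy.1

/-! ### A uniform lower bound for horizontal sections -/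

/-- The points whose orbit converges to one of the two invariant boundary lines. -/
def attractedToBoundary (β₁ β₂ : ℝ) : Set (ℝ × ℝ) := attractedTo β₁ β₂ 0 ∪ attractedTo β₁ β₂ 1

/-- The horizontal section at height `y` of `attractedToBoundary`. -/
def boundarySection (β₁ β₂ y : ℝ) : Set ℝ := {x | (x, y) ∈ attractedToBoundary β₁ β₂}

theorem measurableSet_attractedToBoundary (β₁ β₂ : ℝ) :
    MeasurableSet (attractedToBoundary β₁ β₂) :=
  (measurableSet_attractedTo β₁ β₂ 0).union (measurableSet_attractedTo β₁ β₂ 1)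

theorem measurableSet_boundarySection (β₁ β₂ y : ℝ) : MeasurableSet (boundarySection β₁ β₂ y) :=
  measurable_prodMk_right (measurableSet_attractedToBoundary β₁ β₂)

theorem mem_attractedToBoundary_iff_skewProduct (β₁ β₂ : ℝ) (p : ℝ × ℝ) :
    p ∈ attractedToBoundary β₁ β₂ ↔ skewProduct β₁ β₂ p ∈ attractedToBoundary β₁ β₂ :=
  or_congr (mem_attractedTo_iff_skewProduct β₁ β₂ 0 p) (mem_attractedTo_iff_skewProduct β₁ β₂ 1 p)

theorem mem_boundarySection_of_le_half {β₁ β₂ x y : ℝ} (hx : x ≤ 1 / 2) :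
    x ∈ boundarySection β₁ β₂ y ↔ 2 * x ∈ boundarySection β₁ β₂ (fiberOne β₁ y) := by
  refine (mem_attractedToBoundary_iff_skewProduct β₁ β₂ (x, y)).trans ?_
  simp only [skewProduct, doubling, if_pos hx]
  rfl

theorem mem_boundarySection_of_half_lt {β₁ β₂ x y : ℝ} (hx : ¬ x ≤ 1 / 2) :
    x ∈ boundarySection β₁ β₂ y ↔ 2 * x - 1 ∈ boundarySection β₁ β₂ (fiberTwo β₂ y) := by
  refine (mem_attractedToBoundary_iff_skewProduct β₁ β₂ (x, y)).trans ?_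
  simp only [skewProduct, doubling, if_neg hx]
  rfl

theorem boundarySection_one_sub (β₁ β₂ y : ℝ) :
    boundarySection β₁ β₂ (1 - y) = boundarySection (1 - β₁) (1 - β₂) y := by
  ext x
  have h0 := mem_attractedTo_one_sub_iff β₁ β₂ 0 x y
  have h1 := mem_attractedTo_one_sub_iff β₁ β₂ 1 x y
  rw [sub_zero] at h0
  rw [sub_self] at h1
  exact (or_congr h1 h0).trans or_comm

theorem half_mul_le_of_two_inv_mul_le {s t : Set ℝ} (h : 2⁻¹ * baseMeasure s ≤ baseMeasure t) :
    1 / 2 * baseMeasure.real s ≤ baseMeasure.real t := by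
  have := ENNReal.toReal_mono (measure_ne_top _ _) h
  simpa [Measure.real] using this

theorem half_mul_boundarySection_fiberOne_le (β₁ β₂ y : ℝ) :
    1 / 2 * baseMeasure.real (boundarySection β₁ β₂ (fiberOne β₁ y)) ≤
      baseMeasure.real (boundarySection β₁ β₂ y) := by
  refine half_mul_le_of_two_inv_mul_le ?_
  rw [← baseMeasure_left]
  exact measure_mono fun x hx => (mem_boundarySection_of_le_half hx.1).2 hx.2

theorem half_mul_boundarySection_fiberTwo_le (β₁ β₂ y : ℝ) :
    1 / 2 * baseMeasure.real (boundarySection β₁ β₂ (fiberTwo β₂ y)) ≤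
      baseMeasure.real (boundarySection β₁ β₂ y) := by
  refine half_mul_le_of_two_inv_mul_le ?_
  rw [← baseMeasure_right]
  exact measure_mono fun x hx => (mem_boundarySection_of_half_lt hx.1).2 hx.2

/-- Each application of `g` gains height `κ` and costs a factor 1/2; at most about `(u - l) / κ`
applications lead from `l` to above `u`. -/
theorem exists_pos_le_of_climb {p g : ℝ → ℝ} {l u κ c : ℝ} (hκ : 0 < κ) (hc : 0 < c)
    (hg : ∀ y ∈ Ico l u, y + κ ≤ g y) (hg1 : ∀ y ∈ Ico l u, g y ≤ 1)
    (hp : ∀ y, 1 / 2 * p (g y) ≤ p y) (hu : ∀ y ∈ Icc u 1, c ≤ p y) :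
    ∃ c' > 0, ∀ y ∈ Icc l 1, c' ≤ p y := by
  have key : ∀ n : ℕ, ∀ y ∈ Icc l 1, u - n * κ ≤ y → c * (1 / 2) ^ n ≤ p y := by
    intro n
    induction n with
    | zero =>
      intro y hy h
      simpa using hu y ⟨by simpa using h, hy.2⟩
    | succ n ih =>
      intro y hy h
      push_cast at h
      rcases le_or_gt u y with huy | huy
      · refine le_trans ?_ (hu y ⟨huy, hy.2⟩)
        exact mul_le_of_le_one_right hc.le (pow_le_one₀ (by norm_num) (by norm_num))
      · have hstep := hg y ⟨hy.1, huy⟩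
        have := ih (g y) ⟨by linarith [hy.1], hg1 y ⟨hy.1, huy⟩⟩ (by linarith)
        have := hp y
        rw [pow_succ]
        linarith
  obtain ⟨N, hN⟩ := exists_nat_ge ((u - l) / κ)
  rw [div_le_iff₀ hκ] at hN
  exact ⟨c * (1 / 2) ^ N, by positivity, fun y hy => key N y hy (by linarith [hy.1])⟩

theorem half_le_boundarySection {β₁ β₂ i y : ℝ} (hi : i = 0 ∨ i = 1) {C : Set ℝ}
    (hC : 1 / 2 ≤ baseMeasure C) (h : ∀ x ∈ C, (x, y) ∈ attractedTo β₁ β₂ i) :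
    1 / 2 ≤ baseMeasure.real (boundarySection β₁ β₂ y) := by
  have hsub : C ⊆ boundarySection β₁ β₂ y := by
    rcases hi with rfl | rfl
    · exact fun x hx => Or.inl (h x hx)
    · exact fun x hx => Or.inr (h x hx)
  have := ENNReal.toReal_mono (measure_ne_top _ _) (hC.trans (measure_mono hsub))
  simpa [Measure.real] using this

/-- Below the midpoint `m < β₂` the second fiber map pushes up; above `m > β₁` the first does. Every
height outside the lower attracted strip thus climbs to the upper one in boundedly many steps. For
`β₁ = β₂` this fails, since the common fixed height has an empty section. -/
theorem exists_pos_le_boundarySection_of_lt {β₁ β₂ : ℝ} (hβ₁ : β₁ ∈ Ioo (0 : ℝ) 1)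
    (hβ₂ : β₂ ∈ Ioo (0 : ℝ) 1) (hL₀ : normalExponent β₁ β₂ 0 < 0)
    (hL₁ : normalExponent β₁ β₂ 1 < 0) (hβ : β₁ < β₂) :
    ∃ c > 0, ∀ y ∈ Icc (0 : ℝ) 1, c ≤ baseMeasure.real (boundarySection β₁ β₂ y) := by
  obtain ⟨δ₀, ⟨hδ₀, -⟩, C₀, -, hm₀, h₀⟩ := exists_local_attraction_zero hβ₁ hβ₂ hL₀
  obtain ⟨δ₁, ⟨hδ₁, -⟩, C₁, -, hm₁, h₁⟩ := exists_local_attraction_one hβ₁ hβ₂ hL₁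
  obtain ⟨ha0, ha1⟩ := hβ₁
  obtain ⟨hb0, hb1⟩ := hβ₂
  set m := (β₁ + β₂) / 2 with hm
  have hm0 : 0 < m := by linarith
  have hm1 : 0 < 1 - m := by linarith
  have hma : 0 < m - β₁ := by linarith
  have hmb : 0 < β₂ - m := by linarith
  obtain ⟨c₁, hc₁, hp₁⟩ := exists_pos_le_of_climb (g := fiberOne β₁) (l := m) (u := 1 - δ₁)
    (p := fun y => baseMeasure.real (boundarySection β₁ β₂ y))
    -- A lower bound for `y(1 - y)(y - β₁)` on `[m, 1 - δ₁)`, factor by factor.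
    (κ := m * δ₁ * (m - β₁)) (c := 1 / 2) (by positivity) (by norm_num)
    (fun y hy => by
      rw [fiberOne]
      have : m * δ₁ * (m - β₁) ≤ y * (1 - y) * (y - β₁) := by
        have h1 : δ₁ ≤ 1 - y := by linarith [hy.2]
        have h2 : m - β₁ ≤ y - β₁ := by linarith [hy.1]
        have h3 := hy.1
        have h4 : 0 ≤ 1 - y := by linarith
        have h5 : 0 ≤ y := by linarith
        gcongr
      linarith)
    (fun y hy => by
      rw [fiberOne]
      have h1 : 0 ≤ 1 - y := by linarith [hy.2]
      have h3 := hy.1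
      nlinarith [mul_nonneg h1 (by linarith : 0 ≤ y), mul_nonneg h1 h1,
        mul_nonneg h1 (mul_nonneg h1 (by linarith : 0 ≤ y)),
        mul_nonneg (mul_nonneg h1 (by linarith : 0 ≤ y)) ha0.le])
    (half_mul_boundarySection_fiberOne_le β₁ β₂)
    (fun y hy => half_le_boundarySection (.inr rfl) hm₁ fun x hx => h₁ x hx y hy)
  obtain ⟨c₂, hc₂, hp₂⟩ := exists_pos_le_of_climb (g := fiberTwo β₂) (l := δ₀) (u := m)
    (p := fun y => baseMeasure.real (boundarySection β₁ β₂ y))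
    (κ := δ₀ * (1 - m) * (β₂ - m)) (c := c₁) (by positivity) hc₁
    (fun y hy => by
      rw [fiberTwo]
      have : δ₀ * (1 - m) * (β₂ - m) ≤ y * (1 - y) * (β₂ - y) := by
        have h1 : 1 - m ≤ 1 - y := by linarith [hy.2]
        have h2 : β₂ - m ≤ β₂ - y := by linarith [hy.2]
        have h3 := hy.1
        have h4 : 0 ≤ 1 - y := by linarith
        have h5 : 0 ≤ y := by linarith
        gcongr
      linarith)
    (fun y hy => by
      rw [fiberTwo]
      have h1 : 0 ≤ 1 - y := by linarith [hy.2]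
      have h2 : 0 ≤ y := by linarith [hy.1]
      nlinarith [mul_nonneg h1 h2, mul_nonneg h1 h1, mul_nonneg (mul_nonneg h1 h2) h2,
        mul_nonneg (mul_nonneg h1 h2) (sub_nonneg.2 hb1.le)])
    (half_mul_boundarySection_fiberTwo_le β₁ β₂) hp₁
  refine ⟨min c₂ (1 / 2), lt_min hc₂ (by norm_num), fun y hy => ?_⟩
  rcases le_total y δ₀ with h | h
  · exact (min_le_right _ _).trans
      (half_le_boundarySection (.inl rfl) hm₀ fun x hx => h₀ x hx y ⟨hy.1, h⟩)
  · exact (min_le_left _ _).trans (hp₂ y ⟨h, hy.2⟩)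

theorem exists_pos_le_boundarySection {β₁ β₂ : ℝ} (hβ₁ : β₁ ∈ Ioo (0 : ℝ) 1)
    (hβ₂ : β₂ ∈ Ioo (0 : ℝ) 1) (hL₀ : normalExponent β₁ β₂ 0 < 0)
    (hL₁ : normalExponent β₁ β₂ 1 < 0) (hβ : β₁ ≠ β₂) :
    ∃ c > 0, ∀ y ∈ Icc (0 : ℝ) 1, c ≤ baseMeasure.real (boundarySection β₁ β₂ y) := by
  rcases hβ.lt_or_gt with h | h
  · exact exists_pos_le_boundarySection_of_lt hβ₁ hβ₂ hL₀ hL₁ h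
  · obtain ⟨c, hc, hp⟩ := exists_pos_le_boundarySection_of_lt (β₁ := 1 - β₁) (β₂ := 1 - β₂)
      (one_sub_mem_Ioo hβ₁) (one_sub_mem_Ioo hβ₂) (by rwa [normalExponent_one_sub])
      (by rw [← normalExponent_one_sub, sub_sub_cancel, sub_sub_cancel]; exact hL₀) (by linarith)
    refine ⟨c, hc, fun y hy => ?_⟩
    have := hp (1 - y) ⟨by linarith [hy.2], by linarith [hy.1]⟩
    rwa [boundarySection_one_sub, sub_sub_cancel, sub_sub_cancel] at this

/-! ### Density at dyadic scales and full measure -/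

/-- If all horizontal sections have measure at least `c`, then by invariance every point of the base
lies in intervals of length `2⁻ⁿ` in which a given section has density at least `c`. -/
theorem exists_interval_density {β₁ β₂ : ℝ} (hβ₁ : β₁ ∈ Ioo (0 : ℝ) 1) (hβ₂ : β₂ ∈ Ioo (0 : ℝ) 1)
    {c : ENNReal} (hc : ∀ y ∈ Icc (0 : ℝ) 1, c ≤ baseMeasure (boundarySection β₁ β₂ y)) (n : ℕ)
    {x y : ℝ} (hp : (x, y) ∈ unitSquare) :
    ∃ a, 0 ≤ a ∧ a + (1 / 2) ^ n ≤ 1 ∧ x ∈ Icc a (a + (1 / 2) ^ n) ∧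
      2⁻¹ ^ n * c ≤ volume (Ioc a (a + (1 / 2) ^ n) ∩ boundarySection β₁ β₂ y) := by
  induction n generalizing x y with
  | zero =>
    refine ⟨0, le_rfl, by simp, by simpa using hp.1, ?_⟩
    have := hc y hp.2
    rw [baseMeasure_apply, inter_comm] at this
    simpa using this
  | succ n ih =>
    have hFp := skewProduct_mapsTo hβ₁ hβ₂ hp
    by_cases hx : x ≤ 1 / 2
    · simp only [skewProduct, doubling, if_pos hx] at hFp
      obtain ⟨a, ha0, ha1, ⟨hxa, hxb⟩, hv⟩ := ih hFp
      refine ⟨a / 2, by linarith, ?_, ⟨by linarith, ?_⟩, ?_⟩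
      · rw [pow_succ]; linarith [ha1, pow_pos (one_half_pos (α := ℝ)) n]
      · rw [pow_succ]; linarith
      · rw [pow_succ', mul_assoc]
        refine (mul_le_mul_right hv 2⁻¹).trans ?_
        rw [← volume_preimage_two_mul]
        refine measure_mono ?_
        rintro t ⟨⟨hta, htb⟩, ht⟩
        refine ⟨⟨by linarith, by rw [pow_succ]; linarith⟩, ?_⟩
        exact (mem_boundarySection_of_le_half (by linarith)).2 ht
    · simp only [skewProduct, doubling, if_neg hx] at hFp
      obtain ⟨a, ha0, ha1, ⟨hxa, hxb⟩, hv⟩ := ih hFp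
      -- The density is counted on half-open intervals because the left endpoint may be 1/2, which
      -- belongs to the other branch.
      refine ⟨(a + 1) / 2, by linarith, ?_, ⟨by linarith, ?_⟩, ?_⟩
      · rw [pow_succ]; linarith
      · rw [pow_succ]; linarith
      · rw [pow_succ', mul_assoc]
        refine (mul_le_mul_right hv 2⁻¹).trans ?_
        rw [← volume_preimage_two_mul_sub_one]
        refine measure_mono ?_
        rintro t ⟨⟨hta, htb⟩, ht⟩
        refine ⟨⟨by linarith, by rw [pow_succ]; linarith⟩, ?_⟩
        exact (mem_boundarySection_of_half_lt (by linarith)).2 ht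

/-- The ball of radius `2⁻ⁿ` about `x` contains the given interval and has twice its length, so `t`
fills at least `c / 2` of it. This contradicts density 1 of `tᶜ` at almost every point of `s`. The
density theorem is applied to `tᶜ`, so `s` need not be measurable. -/
theorem volume_eq_zero_of_interval_density {s t : Set ℝ}
    (hst : Disjoint s t) (ht : MeasurableSet t) {c : ENNReal} (hc : c ≠ 0)
    (h : ∀ x ∈ s, ∀ n : ℕ, ∃ a, x ∈ Icc a (a + (1 / 2) ^ n) ∧
      2⁻¹ ^ n * c ≤ volume (Ioc a (a + (1 / 2 : ℝ) ^ n) ∩ t)) : volume s = 0 := by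
  by_contra hne
  have hae := (ae_restrict_iff' ht.compl).1
    (Besicovitch.ae_tendsto_measure_inter_div volume tᶜ)
  obtain ⟨x, hxs, hx⟩ : ∃ x ∈ s, Tendsto
      (fun r => volume (tᶜ ∩ Metric.closedBall x r) / volume (Metric.closedBall x r)) (𝓝[>] 0)
      (𝓝 1) := by
    by_contra! hcon
    refine hne (measure_mono_null (fun x hx => ?_) hae)
    intro hx'
    exact hcon x hx (hx' (fun hxt => hst.le_bot ⟨hx, hxt⟩))
  have hr : Tendsto (fun n : ℕ => (1 / 2 : ℝ) ^ n) atTop (𝓝[>] 0) :=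
    tendsto_nhdsWithin_iff.2 ⟨tendsto_pow_atTop_nhds_zero_of_lt_one (by norm_num) (by norm_num),
      Eventually.of_forall fun n => by simp⟩
  have hlim := hx.comp hr
  have hbound : ∀ n : ℕ, volume (tᶜ ∩ Metric.closedBall x ((1 / 2 : ℝ) ^ n)) /
      volume (Metric.closedBall x ((1 / 2 : ℝ) ^ n)) + c / 2 ≤ 1 := by
    intro n
    obtain ⟨a, hxa, ha⟩ := h x hxs n
    have hvol : volume (Metric.closedBall x ((1 / 2 : ℝ) ^ n)) = 2 * 2⁻¹ ^ n := by
      rw [Real.volume_closedBall, ENNReal.ofReal_mul two_pos.le, ENNReal.ofReal_pow (by norm_num)]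
      simp [ENNReal.ofReal_inv_of_pos]
    have hsub : Ioc a (a + (1 / 2 : ℝ) ^ n) ∩ t ⊆ Metric.closedBall x ((1 / 2 : ℝ) ^ n) ∩ t := by
      refine inter_subset_inter_left _ fun z hz => ?_
      rw [Real.closedBall_eq_Icc]
      exact ⟨by linarith [hz.1, hxa.2], by linarith [hz.2, hxa.1]⟩
    have hsum := measure_inter_add_sdiff (μ := volume) (Metric.closedBall x ((1 / 2 : ℝ) ^ n)) ht
    rw [hvol] at hsum ⊢
    have h0 : (2 : ENNReal) * 2⁻¹ ^ n ≠ 0 := by simp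
    have hT : (2 : ENNReal) * 2⁻¹ ^ n ≠ ⊤ :=
      ENNReal.mul_ne_top (by simp) (ENNReal.pow_ne_top (by simp))
    have hc2 : c / 2 = 2⁻¹ ^ n * c / (2 * 2⁻¹ ^ n) := by
      rw [mul_comm (2⁻¹ ^ n) c]
      exact (ENNReal.mul_div_mul_right c 2 (by simp) (ENNReal.pow_ne_top (by simp))).symm
    rw [hc2, ENNReal.div_add_div_same]
    refine ENNReal.div_le_of_le_mul ?_
    rw [one_mul, ← hsum, add_comm, inter_comm tᶜ]
    gcongr
    · exact ha.trans (measure_mono hsub)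
    · exact subset_rfl
  have hle := le_of_tendsto' (hlim.add_const (c / 2)) hbound
  have : c / 2 ≠ 0 := by simp [hc]
  exact (ENNReal.lt_add_right ENNReal.one_ne_top this).not_ge hle

/-- By Fubini it suffices that each horizontal section of the complement is null. -/
theorem volume_unitSquare_diff_attractedToBoundary {β₁ β₂ : ℝ} (hβ₁ : β₁ ∈ Ioo (0 : ℝ) 1)
    (hβ₂ : β₂ ∈ Ioo (0 : ℝ) 1) {c : ℝ} (hc0 : 0 < c)
    (hc : ∀ y ∈ Icc (0 : ℝ) 1, c ≤ baseMeasure.real (boundarySection β₁ β₂ y)) :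
    volume (unitSquare \ attractedToBoundary β₁ β₂) = 0 := by
  have hmeas : MeasurableSet (unitSquare \ attractedToBoundary β₁ β₂) :=
    (measurableSet_Icc.prod measurableSet_Icc).diff (measurableSet_attractedToBoundary β₁ β₂)
  rw [Measure.volume_eq_prod, Measure.prod_apply_symm hmeas]
  refine (lintegral_congr fun y => ?_).trans lintegral_zero
  have hs : (fun x => (x, y)) ⁻¹' (unitSquare \ attractedToBoundary β₁ β₂) =
      {x | (x, y) ∈ unitSquare} \ boundarySection β₁ β₂ y := rfl
  refine volume_eq_zero_of_interval_density (t := boundarySection β₁ β₂ y)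
    (hs ▸ disjoint_sdiff_left)
    (measurableSet_boundarySection β₁ β₂ y) (ENNReal.ofReal_pos.2 hc0).ne' fun x hx n => ?_
  obtain ⟨a, -, -, hxa, hv⟩ := exists_interval_density hβ₁ hβ₂ (c := ENNReal.ofReal c)
    (fun y hy => ENNReal.ofReal_le_of_le_toReal (hc y hy)) n hx.1
  exact ⟨a, hxa, hv⟩

theorem volume_unitSquare_diff_basins {β₁ β₂ : ℝ} (hβ₁ : β₁ ∈ Ioo (0 : ℝ) 1)
    (hβ₂ : β₂ ∈ Ioo (0 : ℝ) 1) (hL₀ : normalExponent β₁ β₂ 0 < 0)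
    (hL₁ : normalExponent β₁ β₂ 1 < 0) (hβ : β₁ ≠ β₂) :
    volume (unitSquare \ (basin (skewProduct β₁ β₂) (attractor 0) ∪
      basin (skewProduct β₁ β₂) (attractor 1))) = 0 := by
  obtain ⟨c, hc0, hc⟩ := exists_pos_le_boundarySection hβ₁ hβ₂ hL₀ hL₁ hβ
  refine measure_mono_null ?_ (volume_unitSquare_diff_attractedToBoundary hβ₁ hβ₂ hc0 hc)
  rintro p ⟨hp, hpb⟩
  refine ⟨hp, fun h => hpb (h.imp ?_ ?_)⟩ <;>
  exact mem_basin_of_mem_attractedTo hβ₁ hβ₂ hp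

end CubicSkew

/-- The first conjunct says that `normalExponent β₁ β₂ i` is the normal Lyapunov exponent of the
skew product at Lebesgue-almost every point of `[0,1] × {i}`, for `i = 0, 1`. -/
theorem corollary4p6 (β₁ β₂ : ℝ) (hβ₁ : β₁ ∈ Set.Ioo (0 : ℝ) 1) (hβ₂ : β₂ ∈ Set.Ioo (0 : ℝ) 1) :
    (∀ i ∈ ({0, 1} : Set ℝ),
      ∀ᵐ x ∂(volume.restrict (Set.Icc (0 : ℝ) 1)), ∀ v : ℝ × ℝ, CubicSkew.normalPart v ≠ 0 →
        CubicSkew.HasNormalLyapunovExponentAt (CubicSkew.skewProduct β₁ β₂) (x, i) v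
          (CubicSkew.normalExponent β₁ β₂ i)) ∧
    (CubicSkew.normalExponent β₁ β₂ 0 < 0 → CubicSkew.normalExponent β₁ β₂ 1 < 0 →
      0 < volume (CubicSkew.basin (CubicSkew.skewProduct β₁ β₂) (CubicSkew.attractor 0)) ∧
      0 < volume (CubicSkew.basin (CubicSkew.skewProduct β₁ β₂) (CubicSkew.attractor 1)) ∧
      (β₁ ≠ β₂ →
        volume (CubicSkew.unitSquare \
          (CubicSkew.basin (CubicSkew.skewProduct β₁ β₂) (CubicSkew.attractor 0) ∪
            CubicSkew.basin (CubicSkew.skewProduct β₁ β₂) (CubicSkew.attractor 1))) = 0)) := by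
  refine ⟨fun i hi => CubicSkew.ae_hasNormalLyapunovExponentAt hβ₁ hβ₂ hi, fun hL₀ hL₁ => ?_⟩
  exact ⟨CubicSkew.volume_basin_zero_pos hβ₁ hβ₂ hL₀, CubicSkew.volume_basin_one_pos hβ₁ hβ₂ hL₁,
    CubicSkew.volume_unitSquare_diff_basins hβ₁ hβ₂ hL₀ hL₁⟩
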